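/- Let $r\in\{1,2,\dots,\infty\}$ and let $M$ be a compact (Hausdorff, boundaryless, finite-dimensional) $C^r$ manifold with a continuous Riemannian metric tensor, and let $\rho$ be the induced Riemannian distance. ($M$ need not be connected; if it is not, $\rho$ is any metric inducing the topology of $M$ that agrees with the Riemannian distance on each connected component.) Let $X\subset M$ be compact, let $\mu$ be a Borel probability measure on $X$, and let $k\in\mathbb N$. Equip $C^r(M,\mathbb R^k)$ with the topology of uniform convergence of all derivatives of (finite) orders up to $r$ in charts, on compact subsets of the chart domains. A subset of this space is called prevalent if it contains a Borel set $B$ for which there is a Borel measure $\nu$ on $C^r(M,\mathbb R^k)$, positive and finite on some compact set, such that for every $\psi\in C^r(M,\mathbb R^k)$ one has $\psi+e\in B$ for $\nu$-almost every $e$. Then the set of $\phi\in C^r(M,\mathbb R^k)$ with both of the following properties is prevalent. 1. If $k>\dim_H X$ (Hausdorff dimension with respect to $\rho$) and $k\ge\dim M$, then for $\mu$-a.e. $x\in X$ there is $C=C(x,\phi)\in[0,\infty)$ such that $\rho(x,y)\le C\,\|\phi(x)-\phi(y)\|$ for every $y\in X$. 2. If $k>\dim M$, then for $\mu$-a.e.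 $x\in X$ there are open neighbourhoods $U$ of $x$ in $M$ and $V$ of $\phi(x)$ in $\mathbb R^k$ such that $\phi^{-1}(V)=U$, the set $V\cap\phi(M)$ is an embedded $C^r$ submanifold of $\mathbb R^k$ of dimension $\dim M$, and $\phi$ restricts to a $C^r$ diffeomorphism from $U$ onto $V\cap\phi(M)$. -/

import Mathlib

open MeasureTheory Set Manifold Bundle
open scoped Manifold ContDiff Topology ENNReal

/-- Prevalence in a topological vector space `V` (used when `V` is completely metrizable).
A Borel set `B` is prevalent if there is a Borel measure `ν` on `V`, positive and finite on some
compact set, such that for every `v` one has `v + e ∈ B` for `ν`-almost every `e`.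
An arbitrary set is prevalent if it contains a prevalent Borel set. -/
def IsPrevalent {V : Type*} [AddCommGroup V] [TopologicalSpace V] (S : Set V) : Prop :=
  ∃ B : Set V, B ⊆ S ∧ MeasurableSet[borel V] B ∧
    ∃ ν : @Measure V (borel V),
      (∃ K : Set V, IsCompact K ∧ 0 < ν K ∧ ν K < ⊤) ∧
      ∀ v : V, ν {e : V | v + e ∉ B} = 0

/-- The `C^r` topology on `C^r(M, F)`: the coarsest topology for which, for every chart `c` in the
maximal `C^r` atlas of `M` and every finite order `j ≤ r`, the map sending `f` to the `j`-th
derivative of `f ∘ c⁻¹` is continuous for uniform convergence on compact subsets of the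
range of `c`. For compact `M` this is uniform convergence of all derivatives of orders up to
`r`. -/
noncomputable instance contMDiffMapTopology {d : ℕ} {M : Type*} [TopologicalSpace M]
    [ChartedSpace (EuclideanSpace ℝ (Fin d)) M]
    {F : Type*} [NormedAddCommGroup F] [NormedSpace ℝ F] (r : ℕ∞) :
    TopologicalSpace C^(r : ℕ∞ω)⟮𝓡 d, M; 𝓘(ℝ, F), F⟯ :=
  ⨅ c ∈ IsManifold.maximalAtlas (𝓡 d) (r : ℕ∞ω) M, ⨅ j : ℕ, ⨅ _ : (j : ℕ∞) ≤ r,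
    TopologicalSpace.induced
      (fun f => UniformOnFun.ofFun
        {K : Set (EuclideanSpace ℝ (Fin d)) | IsCompact K ∧ K ⊆ c.target}
        (iteratedFDeriv ℝ j (fun z => f (c.symm z))))
      inferInstance

/-- The metric of `M` (which induces the manifold topology) is the Riemannian distance: any two
points joined by a `C^1` path, that is any two points in the same connected component, are at
distance the infimum of the lengths of such paths. The metric tensor puts no constraint on points in
different components, where this infimum is infinite.
For connected `M` this says that the metric is the Riemannian distance. -/
def IsRiemannianDist (d : ℕ) (M : Type*) [MetricSpace M]
    [ChartedSpace (EuclideanSpace ℝ (Fin d)) M]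
    [RiemannianBundle (fun x : M => TangentSpace (𝓡 d) x)] : Prop :=
  ∀ x y : M, riemannianEDist (𝓡 d) x y ≠ ⊤ → edist x y = riemannianEDist (𝓡 d) x y

/-- `S ⊆ ℝ^k` is an embedded `C^r` submanifold of dimension `d`: around each of its points there
is a `C^r` diffeomorphism between open subsets of `ℝ^k` which straightens `S` to
`ℝ^d × {0}`. -/
def IsEmbeddedSubmanifold (r : ℕ∞) (d : ℕ) {k : ℕ} (S : Set (EuclideanSpace ℝ (Fin k))) : Prop :=
  d ≤ k ∧ ∀ p ∈ S,
    ∃ Φ : OpenPartialHomeomorph (EuclideanSpace ℝ (Fin k)) (EuclideanSpace ℝ (Fin k)),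
      p ∈ Φ.source ∧
      ContDiffOn ℝ (r : ℕ∞ω) Φ Φ.source ∧
      ContDiffOn ℝ (r : ℕ∞ω) Φ.symm Φ.target ∧
      Φ '' (Φ.source ∩ S) = Φ.target ∩ {z | ∀ i : Fin k, d ≤ (i : ℕ) → z i = 0}

/-- `f` restricts to a `C^r` diffeomorphism from the open set `U` of the `d`-dimensional manifold
`M` onto the set `S ⊆ ℝ^k`: the latter is an embedded `C^r` submanifold of dimension `d`, and
`f : U → S` is a `C^r` bijection whose inverse `S → U` is `C^r`. As usual, a map on an embedded
submanifold is `C^r` if near each point of it it extends to a `C^r` map on an open subset of the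
ambient space. -/
structure IsCrDiffeoOnto (r : ℕ∞) (d : ℕ) {k : ℕ} {M : Type*} [TopologicalSpace M]
    [ChartedSpace (EuclideanSpace ℝ (Fin d)) M]
    (f : M → EuclideanSpace ℝ (Fin k)) (U : Set M) (S : Set (EuclideanSpace ℝ (Fin k))) :
    Prop where
  isOpen : IsOpen U
  submanifold : IsEmbeddedSubmanifold r d S
  bijOn : BijOn f U S
  contMDiffOn : ContMDiffOn (𝓡 d) (𝓘(ℝ, EuclideanSpace ℝ (Fin k))) (r : ℕ∞ω) f U
  contMDiffOn_inverse : ∀ p ∈ S, ∃ W : Set (EuclideanSpace ℝ (Fin k)), IsOpen W ∧ p ∈ W ∧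
    ∃ ψ : EuclideanSpace ℝ (Fin k) → M,
      ContMDiffOn (𝓘(ℝ, EuclideanSpace ℝ (Fin k))) (𝓡 d) (r : ℕ∞ω) ψ W ∧
      ∀ u ∈ U, f u ∈ W → ψ (f u) = u

section RiemannianDistance

open Filter Metric
open scoped NNReal

variable {d : ℕ} {M : Type*} [TopologicalSpace M]
  [ChartedSpace (EuclideanSpace ℝ (Fin d)) M] [IsManifold (𝓡 d) 1 M]
  [RiemannianBundle (fun x : M => TangentSpace (𝓡 d) x)]
  [IsContinuousRiemannianBundle (EuclideanSpace ℝ (Fin d)) (fun x : M => TangentSpace (𝓡 d) x)]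
  {F : Type*} [NormedAddCommGroup F] [NormedSpace ℝ F]

lemma ContinuousLinearMap.enorm_apply_le_of_enorm_lt {V W : Type*}
    {_ : SeminormedAddCommGroup V} {_ : NormedSpace ℝ V} {_ : SeminormedAddCommGroup W}
    {_ : NormedSpace ℝ W} {L : V →L[ℝ] W} {C : ℝ≥0}
    (h : ‖L‖ₑ < C) (v : V) : ‖L v‖ₑ ≤ C * ‖v‖ₑ :=
  (L.le_opENorm v).trans (by gcongr)

/-- The differential of a `C^1` function is locally bounded for the Riemannian norm. -/
lemma eventually_enorm_mfderiv_apply_le {f : M → F} (hf : ContMDiff (𝓡 d) 𝓘(ℝ, F) 1 f) (x : M) :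
    ∃ C : ℝ≥0, ∀ᶠ y in 𝓝 x, ∀ v : TangentSpace (𝓡 d) y,
      @enorm F _ (mfderiv (𝓡 d) 𝓘(ℝ, F) f y v) ≤ C * ‖v‖ₑ := by
  obtain ⟨C, -, hC⟩ := eventually_enorm_mfderiv_extChartAt_lt (𝓡 d) x
  set g : EuclideanSpace ℝ (Fin d) → F := f ∘ (extChartAt (𝓡 d) x).symm with hg
  have hgs : ContDiffOn ℝ 1 g (extChartAt (𝓡 d) x).target :=
    contMDiffOn_iff_contDiffOn.1 (hf.comp_contMDiffOn (contMDiffOn_extChartAt_symm x))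
  have hopen : IsOpen (extChartAt (𝓡 d) x).target := isOpen_extChartAt_target x
  have hcont : ContinuousOn (fun z => ‖fderiv ℝ g z‖ₑ) (extChartAt (𝓡 d) x).target :=
    (hgs.continuousOn_fderiv_of_isOpen hopen le_rfl).enorm
  have hxt : extChartAt (𝓡 d) x x ∈ (extChartAt (𝓡 d) x).target := mem_extChartAt_target x
  set D : ℝ≥0 := ‖fderiv ℝ g (extChartAt (𝓡 d) x x)‖₊ + 1 with hD
  have hlt : ∀ᶠ z in 𝓝 (extChartAt (𝓡 d) x x), ‖fderiv ℝ g z‖ₑ < D := by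
    refine (hcont.continuousAt (hopen.mem_nhds hxt)).eventually_lt_const ?_
    change ‖fderiv ℝ g (extChartAt (𝓡 d) x x)‖ₑ < _
    rw [enorm_eq_nnnorm, hD]
    exact_mod_cast lt_add_one _
  have hlt' := (continuousAt_extChartAt (I := 𝓡 d) x).eventually hlt
  refine ⟨D * C, ?_⟩
  filter_upwards [hC, hlt', extChartAt_source_mem_nhds (I := 𝓡 d) x] with y hy hy' hys v
  have hyt : extChartAt (𝓡 d) x y ∈ (extChartAt (𝓡 d) x).target :=
    (extChartAt (𝓡 d) x).map_source hys
  have hext : MDifferentiableAt (𝓡 d) 𝓘(ℝ, EuclideanSpace ℝ (Fin d)) (extChartAt (𝓡 d) x) y :=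
    mdifferentiableAt_extChartAt (by simpa using hys)
  have hgd : DifferentiableAt ℝ g (extChartAt (𝓡 d) x y) :=
    (hgs.contDiffAt (hopen.mem_nhds hyt)).differentiableAt one_ne_zero
  have hfg : f =ᶠ[𝓝 y] g ∘ extChartAt (𝓡 d) x := by
    filter_upwards [(isOpen_extChartAt_source (I := 𝓡 d) x).mem_nhds hys] with w hw
    simp only [hg, Function.comp_apply, (extChartAt (𝓡 d) x).left_inv hw]
  have hcomp : mfderiv (𝓡 d) 𝓘(ℝ, F) f y = (mfderiv 𝓘(ℝ, EuclideanSpace ℝ (Fin d)) 𝓘(ℝ, F) g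
      (extChartAt (𝓡 d) x y)).comp
      (mfderiv (𝓡 d) 𝓘(ℝ, EuclideanSpace ℝ (Fin d)) (extChartAt (𝓡 d) x) y) := by
    rw [hfg.mfderiv_eq]
    exact mfderiv_comp y hgd.mdifferentiableAt hext
  have h1 : mfderiv (𝓡 d) 𝓘(ℝ, F) f y v = fderiv ℝ g (extChartAt (𝓡 d) x y)
      (mfderiv (𝓡 d) 𝓘(ℝ, EuclideanSpace ℝ (Fin d)) (extChartAt (𝓡 d) x) y v) := by
    rw [hcomp, mfderiv_eq_fderiv]; rfl
  have h2 : @enorm (EuclideanSpace ℝ (Fin d)) _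
      (mfderiv (𝓡 d) 𝓘(ℝ, EuclideanSpace ℝ (Fin d)) (extChartAt (𝓡 d) x) y v) ≤ C * ‖v‖ₑ :=
    ContinuousLinearMap.enorm_apply_le_of_enorm_lt hy v
  rw [h1]
  refine (ContinuousLinearMap.enorm_apply_le_of_enorm_lt hy' _).trans ?_
  refine (mul_le_mul_right h2 (D : ℝ≥0∞)).trans ?_
  rw [← mul_assoc, ENNReal.coe_mul]

/-- A `C^1` function on a compact manifold is Lipschitz for the Riemannian distance. -/
lemma exists_edist_le_riemannianEDist [CompactSpace M] {f : M → F}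
    (hf : ContMDiff (𝓡 d) 𝓘(ℝ, F) 1 f) :
    ∃ C : ℝ≥0, ∀ x y, edist (f x) (f y) ≤ C * riemannianEDist (𝓡 d) x y := by
  obtain ⟨C, hC⟩ : ∃ C : ℝ≥0, ∀ y, ∀ v : TangentSpace (𝓡 d) y,
      @enorm F _ (mfderiv (𝓡 d) 𝓘(ℝ, F) f y v) ≤ C * ‖v‖ₑ := by
    have := isCompact_univ.induction_on (X := M) (p := fun s => ∃ C : ℝ≥0, ∀ y ∈ s,
      ∀ v : TangentSpace (𝓡 d) y, @enorm F _ (mfderiv (𝓡 d) 𝓘(ℝ, F) f y v) ≤ C * ‖v‖ₑ)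
      ⟨0, by simp⟩ (fun s t hst ⟨C, hC⟩ => ⟨C, fun y hy => hC y (hst hy)⟩)
      (fun s t ⟨C, hC⟩ ⟨D, hD⟩ => ⟨max C D, fun y hy v => by
        rcases hy with hy | hy
        · exact (hC y hy v).trans (by gcongr; exact le_max_left _ _)
        · exact (hD y hy v).trans (by gcongr; exact le_max_right _ _)⟩)
      (fun x _ => by
        obtain ⟨C, hC⟩ := eventually_enorm_mfderiv_apply_le hf x
        exact ⟨_, mem_nhdsWithin_of_mem_nhds hC, C, fun y hy => hy⟩)
    simpa using this
  have key : ∀ x y, ∀ r : ℝ≥0, riemannianEDist (𝓡 d) x y < r → edist (f x) (f y) ≤ C * r := by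
    intro x y r hr
    obtain ⟨γ, rfl, rfl, hγ, hlen⟩ := exists_lt_of_riemannianEDist_lt hr
    have hfγ : ContDiffOn ℝ 1 (f ∘ γ) (Icc 0 1) :=
      contMDiffOn_iff_contDiffOn.1 (hf.comp_contMDiffOn hγ)
    rw [edist_comm, edist_eq_enorm_sub]
    calc ‖f (γ 1) - f (γ 0)‖ₑ ≤ ∫⁻ t in Icc 0 1, ‖derivWithin (f ∘ γ) (Icc 0 1) t‖ₑ :=
          enorm_sub_le_lintegral_derivWithin_Icc_of_contDiffOn_Icc hfγ zero_le_one
      _ ≤ ∫⁻ t in Icc 0 1, C * ‖mfderivWithin 𝓘(ℝ, ℝ) (𝓡 d) γ (Icc 0 1) t 1‖ₑ := by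
        refine setLIntegral_mono' measurableSet_Icc fun t ht => ?_
        have hcomp : mfderivWithin 𝓘(ℝ, ℝ) 𝓘(ℝ, F) (f ∘ γ) (Icc 0 1) t =
            (mfderiv (𝓡 d) 𝓘(ℝ, F) f (γ t)).comp
              (mfderivWithin 𝓘(ℝ, ℝ) (𝓡 d) γ (Icc 0 1) t) := by
          refine mfderiv_comp_mfderivWithin _ (hf.mdifferentiable one_ne_zero _)
            (hγ.mdifferentiableOn one_ne_zero t ht) ?_
          rw [uniqueMDiffWithinAt_iff_uniqueDiffWithinAt]
          exact uniqueDiffOn_Icc zero_lt_one t ht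
        have h1 : derivWithin (f ∘ γ) (Icc 0 1) t = mfderiv (𝓡 d) 𝓘(ℝ, F) f (γ t)
            (mfderivWithin 𝓘(ℝ, ℝ) (𝓡 d) γ (Icc 0 1) t 1) := by
          rw [← fderivWithin_derivWithin, ← mfderivWithin_eq_fderivWithin, hcomp]; rfl
        rw [h1]
        exact hC _ _
      _ = C * pathELength (𝓡 d) γ 0 1 := by
        rw [lintegral_const_mul' _ _ ENNReal.coe_ne_top,
          pathELength_eq_lintegral_mfderivWithin_Icc]
      _ ≤ C * r := by gcongr
  refine ⟨C + 1, fun x y => ?_⟩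
  rcases eq_or_ne (riemannianEDist (𝓡 d) x y) ⊤ with h | h
  · rw [h, ENNReal.mul_top (by simp)]; exact le_top
  refine ENNReal.le_of_forall_pos_le_add fun ε hε _ => ?_
  lift riemannianEDist (𝓡 d) x y to ℝ≥0 using h with R hR
  have h2 := key x y (R + ε / (C + 1)) (by
    rw [← hR]; exact_mod_cast lt_add_of_pos_right _ (by positivity))
  refine h2.trans ?_
  have : C * (R + ε / (C + 1)) ≤ (C + 1) * R + ε := by
    rw [mul_add]
    refine add_le_add (by gcongr; simp) ?_
    rw [← mul_div_assoc, div_le_iff₀ (by positivity)]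
    rw [mul_comm]; gcongr; simp
  exact_mod_cast this


/-- The Riemannian distance is locally controlled by the distance in a chart. -/
lemma eventually_riemannianEDist_le_mul_edist_extChartAt (x : M) :
    ∃ C : ℝ≥0, ∃ u ∈ 𝓝 x, ∀ y ∈ u, ∀ z ∈ u,
      riemannianEDist (𝓡 d) y z ≤ C * edist (extChartAt (𝓡 d) x y) (extChartAt (𝓡 d) x z) := by
  obtain ⟨C, -, hC⟩ := eventually_enorm_mfderivWithin_symm_extChartAt_lt (𝓡 d) x
  have hC' : ∀ᶠ w in 𝓝[range (𝓡 d)] (extChartAt (𝓡 d) x x), ∀ v : EuclideanSpace ℝ (Fin d),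
      ‖mfderivWithin 𝓘(ℝ, EuclideanSpace ℝ (Fin d)) (𝓡 d) (extChartAt (𝓡 d) x).symm
        (range (𝓡 d)) w v‖ₑ ≤ C * ‖v‖ₑ :=
    hC.mono fun w hw v => ContinuousLinearMap.enorm_apply_le_of_enorm_lt hw v
  obtain ⟨r, r_pos, hr⟩ := mem_nhdsWithin_iff.1
    (inter_mem (extChartAt_target_mem_nhdsWithin (I := 𝓡 d) x) hC')
  refine ⟨C, (extChartAt (𝓡 d) x).source ∩
    (extChartAt (𝓡 d) x) ⁻¹' (ball (extChartAt (𝓡 d) x x) r),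
    inter_mem (extChartAt_source_mem_nhds x)
      ((continuousAt_extChartAt x).preimage_mem_nhds (ball_mem_nhds _ r_pos)), ?_⟩
  rintro y ⟨hys, hy⟩ z ⟨hzs, hz⟩
  let η := ContinuousAffineMap.lineMap (R := ℝ) (extChartAt (𝓡 d) x y) (extChartAt (𝓡 d) x z)
  set γ := (extChartAt (𝓡 d) x).symm ∘ η with hγ
  have hη : ∀ t ∈ Icc (0 : ℝ) 1, η t ∈ ball (extChartAt (𝓡 d) x x) r := by
    intro t ht
    refine (convex_ball (extChartAt (𝓡 d) x x) r).segment_subset hy hz ?_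
    rw [segment_eq_image_lineMap]
    exact ⟨t, ht, rfl⟩
  have hη1 : ∀ t ∈ Icc (0 : ℝ) 1, η t ∈ (extChartAt (𝓡 d) x).target :=
    fun t ht => (hr ⟨hη t ht, by simp⟩).1
  have η_smooth : ContMDiffOn 𝓘(ℝ, ℝ) 𝓘(ℝ, EuclideanSpace ℝ (Fin d)) 1 η (Icc 0 1) :=
    (contMDiff_iff_contDiff.2 (ContinuousAffineMap.contDiff _)).contMDiffOn
  have h1 : riemannianEDist (𝓡 d) y z ≤ pathELength (𝓡 d) γ 0 1 := by
    apply riemannianEDist_le_pathELength _ _ _ zero_le_one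
    · exact (contMDiffOn_extChartAt_symm x).comp η_smooth hη1
    · simpa [γ, η, ContinuousAffineMap.coe_lineMap_eq] using (extChartAt (𝓡 d) x).left_inv hys
    · simpa [γ, η, ContinuousAffineMap.coe_lineMap_eq] using (extChartAt (𝓡 d) x).left_inv hzs
  refine h1.trans ?_
  rw [← lintegral_fderiv_lineMap_eq_edist, pathELength_eq_lintegral_mfderivWithin_Icc,
    ← lintegral_const_mul' _ _ ENNReal.coe_ne_top]
  refine setLIntegral_mono' measurableSet_Icc fun t ht => ?_
  have hcomp : mfderivWithin 𝓘(ℝ, ℝ) (𝓡 d) γ (Icc 0 1) t =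
      (mfderivWithin 𝓘(ℝ, EuclideanSpace ℝ (Fin d)) (𝓡 d) (extChartAt (𝓡 d) x).symm
        (range (𝓡 d)) (η t)).comp
      (mfderivWithin 𝓘(ℝ, ℝ) 𝓘(ℝ, EuclideanSpace ℝ (Fin d)) η (Icc 0 1) t) := by
    apply mfderivWithin_comp
    · exact mdifferentiableWithinAt_extChartAt_symm (hη1 t ht)
    · exact η_smooth.mdifferentiableOn one_ne_zero t ht
    · exact fun s hs => by simp
    · rw [uniqueMDiffWithinAt_iff_uniqueDiffWithinAt]
      exact uniqueDiffOn_Icc zero_lt_one t ht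
  have h2 : mfderivWithin 𝓘(ℝ, ℝ) (𝓡 d) γ (Icc 0 1) t 1 =
      mfderivWithin 𝓘(ℝ, EuclideanSpace ℝ (Fin d)) (𝓡 d) (extChartAt (𝓡 d) x).symm
        (range (𝓡 d)) (η t) (fderivWithin ℝ η (Icc 0 1) t 1) := by
    rw [hcomp, mfderivWithin_eq_fderivWithin]; rfl
  rw [h2]
  exact (hr ⟨hη t ht, by simp⟩).2 _


end RiemannianDistance

namespace IsRiemannianDist

open Filter Metric
open scoped NNReal

variable {d : ℕ} {M : Type*} [MetricSpace M]
  [ChartedSpace (EuclideanSpace ℝ (Fin d)) M] [IsManifold (𝓡 d) 1 M]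
  [RiemannianBundle (fun x : M => TangentSpace (𝓡 d) x)]
  [IsContinuousRiemannianBundle (EuclideanSpace ℝ (Fin d)) (fun x : M => TangentSpace (𝓡 d) x)]
  {F : Type*} [NormedAddCommGroup F] [NormedSpace ℝ F]

lemma exists_nhds_edist_eq (hρ : IsRiemannianDist d M) (x : M) :
    ∃ u ∈ 𝓝 x, ∀ y ∈ u, ∀ z ∈ u, edist y z = riemannianEDist (𝓡 d) y z := by
  obtain ⟨C, u, hu, h⟩ := eventually_riemannianEDist_le_mul_edist_extChartAt (d := d) x
  refine ⟨u, hu, fun y hy z hz => hρ y z ?_⟩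
  exact ((h y hy z hz).trans_lt (ENNReal.mul_lt_top ENNReal.coe_lt_top (edist_lt_top _ _))).ne

lemma exists_nhds_edist_le_edist_chartAt (hρ : IsRiemannianDist d M) (x : M) :
    ∃ C : ℝ≥0, ∃ u ∈ 𝓝 x, ∀ y ∈ u, ∀ z ∈ u, edist y z ≤
      C * edist (chartAt (EuclideanSpace ℝ (Fin d)) x y)
        (chartAt (EuclideanSpace ℝ (Fin d)) x z) := by
  obtain ⟨C, u, hu, h⟩ := eventually_riemannianEDist_le_mul_edist_extChartAt (d := d) x
  obtain ⟨w, hw, h'⟩ := hρ.exists_nhds_edist_eq x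
  refine ⟨C, u ∩ w, inter_mem hu hw, fun y hy z hz => ?_⟩
  rw [h' y hy.2 z hz.2]
  exact h y hy.1 z hz.1

lemma locallyLipschitz [CompactSpace M] (hρ : IsRiemannianDist d M) {f : M → F}
    (hf : ContMDiff (𝓡 d) 𝓘(ℝ, F) 1 f) : LocallyLipschitz f := by
  obtain ⟨C, hC⟩ := exists_edist_le_riemannianEDist hf
  intro x
  obtain ⟨u, hu, h⟩ := hρ.exists_nhds_edist_eq x
  exact ⟨C, u, hu, fun y hy z hz => by rw [h y hy z hz]; exact hC y z⟩

lemma dimH_univ_le [CompactSpace M] (hρ : IsRiemannianDist d M) : dimH (univ : Set M) ≤ d := by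
  by_contra! hlt
  obtain ⟨x, -, hx⟩ := exists_mem_nhdsWithin_lt_dimH_of_lt_dimH hlt
  obtain ⟨C, u, hu, h⟩ := hρ.exists_nhds_edist_le_edist_chartAt x
  set c := chartAt (EuclideanSpace ℝ (Fin d)) x with hc
  have hv : u ∩ c.source ∈ 𝓝[univ] x :=
    mem_nhdsWithin_of_mem_nhds (inter_mem hu (chart_source_mem_nhds _ x))
  refine (hx _ hv).not_ge ?_
  have himg : c.symm '' (c '' (u ∩ c.source)) = u ∩ c.source := by
    rw [image_image]
    exact (image_congr fun y hy => c.left_inv hy.2).trans (image_id' _)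
  have hlip : LipschitzOnWith C c.symm (c '' (u ∩ c.source)) := by
    rintro _ ⟨y, hy, rfl⟩ _ ⟨z, hz, rfl⟩
    rw [c.left_inv hy.2, c.left_inv hz.2]
    exact h y hy.1 z hz.1
  rw [← himg]
  refine hlip.dimH_image_le.trans ((dimH_mono (subset_univ _)).trans ?_)
  rw [Real.dimH_univ_eq_finrank]
  simp

end IsRiemannianDist

section GenericPerturbation

open scoped NNReal

variable {k : ℕ} {J : Type*} [Fintype J]

lemma EuclideanSpace.volume_eq_zero_of_dimH_lt {s : Set (EuclideanSpace ℝ (Fin k))}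
    (hs : dimH s < k) : volume s = 0 := by
  have h := isAddHaarMeasure_hausdorffMeasure (E := EuclideanSpace ℝ (Fin k))
  rw [finrank_euclideanSpace_fin] at h
  refine measure_zero_of_dimH_lt (d := k) ?_ hs
  rw [NNReal.coe_natCast]
  exact Measure.absolutelyContinuous_isAddHaarMeasure _ _

local notation "F" => EuclideanSpace ℝ (Fin k)

lemma ae_forall_mem_add_sum_smul_ne_zero_of_isCompact {K : Set (F × (J → ℝ))} (hK : IsCompact K)
    (hdim : dimH K < k) (i : J) (hi : ∀ p ∈ K, p.2 i ≠ 0) :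
    ∀ᵐ T : J → F, ∀ p ∈ K, p.1 + ∑ j, p.2 j • T j ≠ 0 := by
  classical
  have hcl : IsClosed {T : J → F | ∃ p ∈ K, p.1 + ∑ j, p.2 j • T j = 0} := by
    have hq : IsClosed {q : (J → F) × K | q.2.1.1 + ∑ j, q.2.1.2 j • q.1 j = 0} :=
      isClosed_eq (by fun_prop) (by fun_prop)
    have : CompactSpace K := isCompact_iff_compactSpace.1 hK
    convert isClosedMap_fst_of_compactSpace (Y := K) _ hq using 1
    ext T
    simp
  have hmeas : MeasurableSet {T : J → F | ∀ p ∈ K, p.1 + ∑ j, p.2 j • T j ≠ 0} := by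
    convert hcl.measurableSet.compl using 1
    ext T; simp
  refine (ae_ae_add_linearMap_mem_iff (LinearMap.single ℝ (fun _ : J => F) i) volume volume
    hmeas).1 (Filter.Eventually.of_forall fun T => ?_)
  set g : F × (J → ℝ) → F := fun p => -((p.2 i)⁻¹ • (p.1 + ∑ j, p.2 j • T j)) with hg
  have hgd : dimH (g '' K) < k := by
    refine (dimH_image_le_of_locally_lipschitzOn fun p hp => ?_).trans_lt hdim
    have hpi : p.2 i ≠ 0 := hi p hp
    have : ContDiffAt ℝ 1 g p := by
      have h1 : ContDiffAt ℝ 1 (fun p : F × (J → ℝ) => p.2 i) p := by fun_prop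
      have h2 : ContDiffAt ℝ 1 (fun p : F × (J → ℝ) => p.1 + ∑ j, p.2 j • T j) p := by fun_prop
      exact ((h1.inv hpi).smul h2).neg
    obtain ⟨C, t, ht, h⟩ := this.exists_lipschitzOnWith
    exact ⟨C, t, mem_nhdsWithin_of_mem_nhds ht, h⟩
  have hnull := EuclideanSpace.volume_eq_zero_of_dimH_lt hgd
  filter_upwards [compl_mem_ae_iff.2 hnull] with u hu p hp h0
  refine hu ⟨p, hp, ?_⟩
  have hpi : p.2 i ≠ 0 := hi p hp
  have hsum : ∑ j, p.2 j • (T + LinearMap.single ℝ (fun _ : J => F) i u) j =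
      ∑ j, p.2 j • T j + p.2 i • u := by
    simp only [Pi.add_apply, smul_add, Finset.sum_add_distrib, LinearMap.single_apply]
    congr 1
    rw [Finset.sum_eq_single i (fun j _ hj => by simp [hj]) (by simp)]
    simp
  rw [hsum, ← add_assoc] at h0
  rw [hg]
  simp only
  rw [eq_neg_of_add_eq_zero_left h0, smul_neg, neg_neg, smul_smul, inv_mul_cancel₀ hpi, one_smul]

/-- If the set `Z` of pairs `(a, b)` has Hausdorff dimension smaller than `k` and `b ≠ 0` on `Z`,
then for almost every `T` the function `(a, b) ↦ a + ∑ b j • T j` with values in `ℝ^k` has no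
zero on `Z`. -/
lemma ae_forall_mem_add_sum_smul_ne_zero {Z : Set (F × (J → ℝ))} (hZ : IsSigmaCompact Z)
    (hdim : dimH Z < k) (hne : ∀ p ∈ Z, p.2 ≠ 0) :
    ∀ᵐ T : J → F, ∀ p ∈ Z, p.1 + ∑ j, p.2 j • T j ≠ 0 := by
  obtain ⟨K, hK, hKZ⟩ := hZ
  have key : ∀ (n m : ℕ) (i : J), ∀ᵐ T : J → F,
      ∀ p ∈ K n ∩ {p | 1 / ((m : ℝ) + 1) ≤ |p.2 i|}, p.1 + ∑ j, p.2 j • T j ≠ 0 := by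
    intro n m i
    refine ae_forall_mem_add_sum_smul_ne_zero_of_isCompact
      ((hK n).inter_right (isClosed_le (by fun_prop) (by fun_prop))) ?_ i ?_
    · exact (dimH_mono (inter_subset_left.trans (hKZ ▸ subset_iUnion K n))).trans_lt hdim
    · rintro p ⟨-, hp⟩ h0
      simp only [mem_ofPred_eq, h0, abs_zero] at hp
      exact (Nat.one_div_pos_of_nat (α := ℝ) (n := m)).not_ge hp
  have := ae_all_iff.2 fun n => ae_all_iff.2 fun m => ae_all_iff.2 fun i => key n m i
  filter_upwards [this] with T hT p hp
  obtain ⟨i, hi⟩ := Function.ne_iff.1 (hne p hp)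
  rw [← hKZ] at hp
  obtain ⟨n, hn⟩ := mem_iUnion.1 hp
  obtain ⟨m, hm⟩ := exists_nat_one_div_lt (abs_pos.2 hi)
  exact hT n m i p ⟨hn, hm.le⟩

end GenericPerturbation

section SeparatingFamily

open Filter

variable {d : ℕ}

local notation "𝔼" d:max => EuclideanSpace ℝ (Fin d)

variable {M : Type*} [TopologicalSpace M]
  [ChartedSpace (𝔼 d) M]

/-- A family of real functions on `M` which separates points and tangent vectors. -/
structure IsSeparatingImmersion {J : Type*} (Ψ : J → M → ℝ) : Prop where
  exists_ne : ∀ x y : M, x ≠ y → ∃ j, Ψ j x ≠ Ψ j y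
  eq_zero_of_fderiv_eq_zero : ∀ (x : M) (v : (𝔼 d)),
    (∀ j, fderiv ℝ (Ψ j ∘ (chartAt (𝔼 d) x).symm)
      (chartAt (𝔼 d) x x) v = 0) → v = 0

lemma SmoothBumpFunction.contMDiff_of_enat (r : ℕ∞) [IsManifold (𝓡 d) (r : ℕ∞ω) M] [T2Space M]
    {p : M} (b : SmoothBumpFunction (𝓡 d) p) : ContMDiff (𝓡 d) 𝓘(ℝ, ℝ) (r : ℕ∞ω) b := by
  refine contMDiff_of_tsupport fun x hx => ?_
  have hxs : x ∈ (chartAt (𝔼 d) p).source :=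
    b.tsupport_subset_chartAt_source hx
  refine ContMDiffAt.congr_of_eventuallyEq ?_ <| b.eqOn_source.eventuallyEq_of_mem <|
    (chartAt _ p).open_source.mem_nhds hxs
  exact b.contDiffAt.contMDiffAt.comp _ (contMDiffAt_extChartAt' hxs)

lemma SmoothBumpFunction.contMDiff_smul_chartAt (r : ℕ∞) [IsManifold (𝓡 d) (r : ℕ∞ω) M]
    [T2Space M] {p : M} (b : SmoothBumpFunction (𝓡 d) p) :
    ContMDiff (𝓡 d) 𝓘(ℝ, (𝔼 d)) (r : ℕ∞ω) fun y => b y • chartAt (𝔼 d) p y := by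
  refine contMDiff_of_tsupport fun x hx => ?_
  have hxs : x ∈ (chartAt (𝔼 d) p).source :=
    b.tsupport_subset_chartAt_source (tsupport_smul_subset_left _ _ hx)
  have h1 : ContMDiffAt (𝓡 d) 𝓘(ℝ, (𝔼 d)) (r : ℕ∞ω) (chartAt (𝔼 d) p) x :=
    contMDiffAt_extChartAt' hxs
  exact (b.contMDiff_of_enat r).contMDiffAt.smul h1

lemma SmoothBumpFunction.contMDiff_mul_chartAt_apply (r : ℕ∞) [IsManifold (𝓡 d) (r : ℕ∞ω) M]
    [T2Space M] {p : M} (b : SmoothBumpFunction (𝓡 d) p) (i : Fin d) :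
    ContMDiff (𝓡 d) 𝓘(ℝ, ℝ) (r : ℕ∞ω) fun y => b y * chartAt (𝔼 d) p y i :=
  (EuclideanSpace.proj (𝕜 := ℝ) i).contMDiff.comp (b.contMDiff_smul_chartAt r)

/-- Where the bump function is locally one, its products with the coordinates of the chart
separate tangent vectors. -/
lemma eq_zero_of_fderiv_bump_mul_chartAt_eq_zero [IsManifold (𝓡 d) 1 M] [T2Space M]
    {p x : M} (b : SmoothBumpFunction (𝓡 d) p)
    (hx : x ∈ (chartAt (𝔼 d) p).source) (hb : b =ᶠ[𝓝 x] 1)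
    {v : (𝔼 d)}
    (hv : ∀ i, fderiv ℝ ((fun y => b y * chartAt (𝔼 d) p y i) ∘
      (chartAt (𝔼 d) x).symm)
      (chartAt (𝔼 d) x x) v = 0) : v = 0 := by
  set c := chartAt (𝔼 d) x with hc
  set e := chartAt (𝔼 d) p with he
  have hcx : x ∈ c.source := mem_chart_source (𝔼 d) x
  have hct : c x ∈ c.target := c.map_source hcx
  have hsymm : c.symm (c x) = x := c.left_inv hcx
  have hcont : Tendsto c.symm (𝓝 (c x)) (𝓝 x) := by
    have := c.symm.continuousAt (x := c x) hct
    rwa [ContinuousAt, hsymm] at this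
  have hcs : ContMDiffAt 𝓘(ℝ, (𝔼 d)) (𝓡 d) 1 c.symm (c x) :=
    (contMDiffOn_chart_symm (I := 𝓡 d)).contMDiffAt (c.open_target.mem_nhds hct)
  have hes : ContMDiffAt 𝓘(ℝ, (𝔼 d)) (𝓡 d) 1 e.symm (e x) :=
    (contMDiffOn_chart_symm (I := 𝓡 d)).contMDiffAt (e.open_target.mem_nhds (e.map_source hx))
  have hcm : ContMDiffAt (𝓡 d) 𝓘(ℝ, (𝔼 d)) 1 c x := contMDiffAt_extChartAt' hcx
  have hem : ContMDiffAt (𝓡 d) 𝓘(ℝ, (𝔼 d)) 1 e x := contMDiffAt_extChartAt' hx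
  have hg : DifferentiableAt ℝ (e ∘ c.symm) (c x) := by
    have : ContMDiffAt 𝓘(ℝ, (𝔼 d)) 𝓘(ℝ, (𝔼 d)) 1 (e ∘ c.symm) (c x) := by
      refine ContMDiffAt.comp (c x) ?_ hcs
      rwa [hsymm]
    exact this.contDiffAt.differentiableAt one_ne_zero
  have hh : DifferentiableAt ℝ (c ∘ e.symm) ((e ∘ c.symm) (c x)) := by
    have h1 : (e ∘ c.symm) (c x) = e x := by simp [hsymm]
    rw [h1]
    have : ContMDiffAt 𝓘(ℝ, (𝔼 d)) 𝓘(ℝ, (𝔼 d)) 1 (c ∘ e.symm) (e x) := by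
      refine ContMDiffAt.comp (e x) ?_ hes
      rwa [e.left_inv hx]
    exact this.contDiffAt.differentiableAt one_ne_zero
  have hgv : fderiv ℝ (e ∘ c.symm) (c x) v = 0 := by
    ext i
    have h1 : ((fun y => b y * e y i) ∘ c.symm) =ᶠ[𝓝 (c x)]
        (EuclideanSpace.proj (𝕜 := ℝ) i : (𝔼 d) →L[ℝ] ℝ) ∘ (e ∘ c.symm) := by
      filter_upwards [hcont.eventually hb] with z hz
      simp [hz]
    have h2 := hv i
    rw [h1.fderiv_eq, fderiv_comp _ (ContinuousLinearMap.differentiableAt _) hg,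
      ContinuousLinearMap.fderiv] at h2
    exact h2
  have hid : (c ∘ e.symm) ∘ (e ∘ c.symm) =ᶠ[𝓝 (c x)] id := by
    filter_upwards [hcont.eventually (e.open_source.mem_nhds hx), c.open_target.mem_nhds hct]
      with z hz hz'
    simp [e.left_inv hz, c.right_inv hz']
  have h3 := hid.fderiv_eq (𝕜 := ℝ)
  rw [fderiv_comp _ hh hg, fderiv_id] at h3
  have h4 := DFunLike.congr_fun h3 v
  simpa [hgv] using h4.symm

theorem exists_isSeparatingImmersion (r : ℕ∞) [IsManifold (𝓡 d) (r : ℕ∞ω) M]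
    [IsManifold (𝓡 d) 1 M] [T2Space M] [CompactSpace M] :
    ∃ (t : Finset M) (Ψ : t × Option (Fin d) → M → ℝ),
      (∀ j, ContMDiff (𝓡 d) 𝓘(ℝ, ℝ) (r : ℕ∞ω) (Ψ j)) ∧ IsSeparatingImmersion (d := d) Ψ := by
  have b : ∀ p : M, SmoothBumpFunction (𝓡 d) p := fun p => Classical.choice inferInstance
  obtain ⟨t, ht⟩ := CompactSpace.elim_nhds_subcover
    (fun p => {x | b p =ᶠ[𝓝 x] 1 ∧ x ∈ (chartAt (𝔼 d) p).source}) fun p =>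
      ((b p).eventuallyEq_one.eventuallyEq_nhds).and (chart_source_mem_nhds (𝔼 d) p)
  have hcover : ∀ x, ∃ p : t, b p =ᶠ[𝓝 x] 1 ∧ x ∈ (chartAt (𝔼 d) (p : M)).source := by
    intro x
    have hx : x ∈ ⋃ p ∈ t, {x | b p =ᶠ[𝓝 x] 1 ∧ x ∈ (chartAt (𝔼 d) p).source} := by
      rw [ht]; exact mem_univ x
    obtain ⟨p, hp, h⟩ := mem_iUnion₂.1 hx
    exact ⟨⟨p, hp⟩, h⟩
  refine ⟨t, fun j y => j.2.elim (b j.1 y) fun i => b j.1 y * chartAt (𝔼 d) (j.1 : M) y i, ?_, ?_, ?_⟩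
  · rintro ⟨p, _ | i⟩
    · exact (b p).contMDiff_of_enat r
    · exact (b p).contMDiff_mul_chartAt_apply r i
  · intro x y hxy
    obtain ⟨p, hp1, hps⟩ := hcover x
    by_contra! h
    have hbx : b p x = 1 := hp1.eq_of_nhds
    have hby : b p y = 1 := by rw [← hbx]; exact (h (p, none)).symm
    have hys : y ∈ (chartAt (𝔼 d) (p : M)).source :=
      (b p).tsupport_subset_chartAt_source (subset_tsupport _ (by rw [Function.mem_support, hby]; exact one_ne_zero))
    refine hxy ((chartAt (𝔼 d) (p : M)).injOn hps hys ?_)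
    ext i
    simpa [hbx, hby] using h (p, some i)
  · intro x v hv
    obtain ⟨p, hp1, hps⟩ := hcover x
    exact eq_zero_of_fderiv_bump_mul_chartAt_eq_zero (b p) hps hp1 fun i => hv (p, some i)

end SeparatingFamily

section LipschitzInverse

open Filter Asymptotics
open scoped NNReal

local notation "𝔼" d:max => EuclideanSpace ℝ (Fin d)

lemma HasFDerivAt.isBigO_sub_of_ker_eq_bot {V W : Type*} [NormedAddCommGroup V] [NormedSpace ℝ V]
    [FiniteDimensional ℝ V] [NormedAddCommGroup W] [NormedSpace ℝ W] {f : V → W} {A : V →L[ℝ] W}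
    {x : V} (hf : HasFDerivAt f A x) (hA : (A : V →ₗ[ℝ] W).ker = ⊥) :
    (fun z => z - x) =O[𝓝 x] fun z => f z - f x := by
  obtain ⟨K, -, hK⟩ := LinearMap.exists_antilipschitzWith (A : V →ₗ[ℝ] W) hA
  have h1 : (fun z => z - x) =O[𝓝 x] fun z => A (z - x) :=
    IsBigO.of_bound K (Eventually.of_forall fun z => by
      simpa [dist_eq_norm] using hK.le_mul_dist z x)
  have h2 : (fun z => f z - f x - A (z - x)) =o[𝓝 x] fun z => A (z - x) :=
    hf.isLittleO.trans_isBigO h1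
  refine h1.trans (h2.right_isBigO_add.congr_right fun z => ?_)
  abel

lemma LinearMap.dimH_setOf_eq_one_lt {V : Type*} [NormedAddCommGroup V] [NormedSpace ℝ V]
    [FiniteDimensional ℝ V] (L : V →ₗ[ℝ] ℝ) {v : V} (hv : L v = 1) :
    dimH {w | L w = 1} < Module.finrank ℝ V := by
  have hker : L.ker ≠ ⊤ := by
    intro h
    have : v ∈ L.ker := h ▸ Submodule.mem_top
    rw [LinearMap.mem_ker, hv] at this
    exact one_ne_zero this
  have hsub : {w | L w = 1} ⊆ (fun u : L.ker => v + u) '' univ := by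
    intro w hw
    refine ⟨⟨w - v, by simp [hv, show L w = 1 from hw]⟩, mem_univ _, by simp⟩
  have hiso : Isometry fun u : L.ker => v + (u : V) :=
    (isometry_add_left v).comp isometry_subtype_coe
  calc dimH {w | L w = 1} ≤ dimH ((fun u : L.ker => v + (u : V)) '' univ) := dimH_mono hsub
    _ = Module.finrank ℝ L.ker := by rw [hiso.dimH_image, Real.dimH_univ_eq_finrank]
    _ < Module.finrank ℝ V := by exact_mod_cast Submodule.finrank_lt hker

/-- A linear map from `ℝ^d` to `ℝ^k`, `d ≤ k`, becomes injective after almost every perturbation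
in a family which separates vectors. -/
lemma ae_ker_add_sum_smulRight_eq_bot {d k : ℕ} (hdk : d ≤ k) {J : Type*} [Fintype J]
    (A : (𝔼 d) →L[ℝ] (𝔼 k)) (B : J → (𝔼 d) →L[ℝ] ℝ) (hB : ∀ v, (∀ j, B j v = 0) → v = 0) :
    ∀ᵐ T : J → (𝔼 k), ∀ v, A v + ∑ j, B j v • T j = 0 → v = 0 := by
  have key : ∀ i : J, ∀ᵐ T : J → (𝔼 k), ∀ v, B i v = 1 → A v + ∑ j, B j v • T j ≠ 0 := by
    intro i
    by_cases hi : ∃ v, B i v = 1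
    · obtain ⟨v, hv⟩ := hi
      set P : (𝔼 d) →L[ℝ] (𝔼 k) × (J → ℝ) := A.prod (ContinuousLinearMap.pi B) with hP
      have hcl : IsClosed {w : (𝔼 d) | B i w = 1} := isClosed_eq (by fun_prop) continuous_const
      have hdim : dimH (P '' {w | B i w = 1}) < k := by
        refine (P.lipschitz.dimH_image_le _).trans_lt ?_
        have := LinearMap.dimH_setOf_eq_one_lt (B i : (𝔼 d) →ₗ[ℝ] ℝ) hv
        rw [finrank_euclideanSpace_fin] at this
        exact this.trans_le (by exact_mod_cast hdk)
      have hs : IsSigmaCompact (P '' {w | B i w = 1}) :=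
        (isSigmaCompact_univ.of_isClosed_subset hcl (subset_univ _)).image P.continuous
      filter_upwards [ae_forall_mem_add_sum_smul_ne_zero hs hdim (by
        rintro _ ⟨w, hw, rfl⟩ h0
        have : B i w = 0 := congrFun h0 i
        rw [show B i w = 1 from hw] at this
        exact one_ne_zero this)] with T hT w hw
      exact hT _ ⟨w, hw, rfl⟩
    · exact Eventually.of_forall fun T v hv => (hi ⟨v, hv⟩).elim
  filter_upwards [ae_all_iff.2 key] with T hT v hv
  by_contra hne
  have : ∃ i, B i v ≠ 0 := by
    by_contra! h
    exact hne (hB v h)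
  obtain ⟨i, hi⟩ := this
  refine hT i ((B i v)⁻¹ • v) (by simp [hi]) ?_
  have : A ((B i v)⁻¹ • v) + ∑ j, B j ((B i v)⁻¹ • v) • T j =
      (B i v)⁻¹ • (A v + ∑ j, B j v • T j) := by
    simp only [map_smul, smul_add, Finset.smul_sum, smul_assoc]
  rw [this, hv, smul_zero]

lemma IsCompact.isSigmaCompact_diff_singleton {Y : Type*} [MetricSpace Y] {X : Set Y}
    (hX : IsCompact X) (x : Y) : IsSigmaCompact (X \ {x}) := by
  have : X \ {x} = ⋃ n : ℕ, X ∩ {y | 1 / ((n : ℝ) + 1) ≤ dist y x} := by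
    ext y
    simp only [Set.mem_sdiff, mem_singleton_iff, mem_iUnion, mem_inter_iff, mem_ofPred_eq]
    refine ⟨fun ⟨hy, hne⟩ => ?_, fun ⟨n, hy, hn⟩ => ⟨hy, ?_⟩⟩
    · obtain ⟨n, hn⟩ := exists_nat_one_div_lt (dist_pos.2 hne)
      exact ⟨n, hy, hn.le⟩
    · rintro rfl
      rw [dist_self] at hn
      exact (Nat.one_div_pos_of_nat (α := ℝ) (n := n)).not_ge hn
  rw [this]
  exact isSigmaCompact_iUnion_of_isCompact _ fun n =>
    hX.inter_right (isClosed_le (by fun_prop) (by fun_prop))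

/-- A continuous map which is injective at `x`, and has a Lipschitz inverse at `x` locally, has
a Lipschitz inverse at `x` on any compact set. -/
lemma IsCompact.exists_dist_le_mul_norm_sub {Y W : Type*} [MetricSpace Y] [NormedAddCommGroup W]
    {X : Set Y} (hX : IsCompact X) {x : Y} {f : Y → W} (hf : Continuous f) {C : ℝ}
    (hloc : ∀ᶠ y in 𝓝 x, dist x y ≤ C * ‖f x - f y‖) (hinj : ∀ y ∈ X, f x = f y → y = x) :
    ∃ C : ℝ, 0 ≤ C ∧ ∀ y ∈ X, dist x y ≤ C * ‖f x - f y‖ := by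
  obtain ⟨u, hu, huo, hxu⟩ := eventually_nhds_iff.1 hloc
  have hK : IsCompact (X \ u) := hX.diff huo
  have hpos : ∀ y ∈ X \ u, 0 < ‖f x - f y‖ := fun y hy =>
    norm_pos_iff.2 (sub_ne_zero.2 fun h => hy.2 (hinj y hy.1 h ▸ hxu))
  obtain ⟨D, hD⟩ := hK.exists_bound_of_continuousOn (f := fun y => dist x y / ‖f x - f y‖)
    (ContinuousOn.div (by fun_prop) (by fun_prop) fun y hy => (hpos y hy).ne')
  refine ⟨max (max C D) 0, le_max_right _ _, fun y hy => ?_⟩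
  by_cases hyu : y ∈ u
  · refine (hu y hyu).trans ?_
    gcongr
    exact (le_max_left _ _).trans (le_max_left _ _)
  · have h1 := hD y ⟨hy, hyu⟩
    have h2 := hpos y ⟨hy, hyu⟩
    rw [Real.norm_of_nonneg (by positivity), div_le_iff₀ h2] at h1
    refine h1.trans ?_
    gcongr
    exact (le_max_right _ _).trans (le_max_left _ _)

variable {d k : ℕ} {M : Type*} [MetricSpace M]
  [ChartedSpace (EuclideanSpace ℝ (Fin d)) M] [IsManifold (𝓡 d) 1 M]

lemma hasFDerivAt_comp_chartAt_symm {F : Type*} [NormedAddCommGroup F] [NormedSpace ℝ F]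
    {f : M → F} (hf : ContMDiff (𝓡 d) 𝓘(ℝ, F) 1 f) (x : M) :
    HasFDerivAt (f ∘ (chartAt (𝔼 d) x).symm)
      (fderiv ℝ (f ∘ (chartAt (𝔼 d) x).symm) (chartAt (𝔼 d) x x)) (chartAt (𝔼 d) x x) := by
  have h : ContDiffOn ℝ 1 (f ∘ (chartAt (𝔼 d) x).symm) (chartAt (𝔼 d) x).target :=
    contMDiffOn_iff_contDiffOn.1 (hf.comp_contMDiffOn (contMDiffOn_chart_symm (I := 𝓡 d)))
  exact ((h.contDiffAt ((chartAt (𝔼 d) x).open_target.mem_nhds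
    (mem_chart_target _ x))).differentiableAt one_ne_zero).hasFDerivAt

theorem ae_exists_dist_le_mul_norm_sub [CompactSpace M]
    [RiemannianBundle (fun x : M => TangentSpace (𝓡 d) x)]
    [IsContinuousRiemannianBundle (EuclideanSpace ℝ (Fin d))
      (fun x : M => TangentSpace (𝓡 d) x)]
    (hρ : IsRiemannianDist d M) {X : Set M} (hX : IsCompact X) (hXk : dimH X < k) (hdk : d ≤ k)
    {J : Type*} [Fintype J] {Ψ : J → M → ℝ} (hΨ : ∀ j, ContMDiff (𝓡 d) 𝓘(ℝ, ℝ) 1 (Ψ j))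
    (hsep : IsSeparatingImmersion (d := d) Ψ) {φ : M → (𝔼 k)}
    (hφ : ContMDiff (𝓡 d) 𝓘(ℝ, (𝔼 k)) 1 φ) (x : M) :
    ∀ᵐ T : J → (𝔼 k), ∃ C : ℝ, 0 ≤ C ∧ ∀ y ∈ X, dist x y ≤
      C * ‖(φ x + ∑ j, Ψ j x • T j) - (φ y + ∑ j, Ψ j y • T j)‖ := by
  have hinj : ∀ᵐ T : J → (𝔼 k), ∀ y ∈ X,
      φ x + ∑ j, Ψ j x • T j = φ y + ∑ j, Ψ j y • T j → y = x := by
    set P : M → (𝔼 k) × (J → ℝ) := fun y => (φ y - φ x, fun j => Ψ j y - Ψ j x) with hP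
    have hPd : ContMDiff (𝓡 d) 𝓘(ℝ, (𝔼 k) × (J → ℝ)) 1 P := by
      refine ContMDiff.prodMk_space (hφ.sub contMDiff_const) ?_
      exact contMDiff_pi_space.2 fun j => (hΨ j).sub contMDiff_const
    have hs : IsSigmaCompact (P '' (X \ {x})) :=
      (hX.isSigmaCompact_diff_singleton x).image hPd.continuous
    have hdim : dimH (P '' (X \ {x})) < k := by
      refine (dimH_image_le_of_locally_lipschitzOn fun y _ => ?_).trans_lt
        ((dimH_mono sdiff_subset).trans_lt hXk)
      obtain ⟨K, t, ht, h⟩ := hρ.locallyLipschitz hPd y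
      exact ⟨K, t, mem_nhdsWithin_of_mem_nhds ht, h⟩
    filter_upwards [ae_forall_mem_add_sum_smul_ne_zero hs hdim (by
      rintro _ ⟨y, hy, rfl⟩ h0
      obtain ⟨j, hj⟩ := hsep.exists_ne y x hy.2
      exact hj (sub_eq_zero.1 (congrFun h0 j)))] with T hT y hy heq
    by_contra hne
    refine hT _ ⟨y, ⟨hy, hne⟩, rfl⟩ ?_
    simp only [hP, sub_smul, Finset.sum_sub_distrib]
    rw [← sub_eq_zero] at heq
    rw [← neg_eq_zero, ← heq]
    abel
  set c := chartAt (𝔼 d) x with hc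
  set A := fderiv ℝ (φ ∘ c.symm) (c x) with hA
  set B := fun j => fderiv ℝ (Ψ j ∘ c.symm) (c x) with hB
  filter_upwards [hinj, ae_ker_add_sum_smulRight_eq_bot hdk A B
    (hsep.eq_zero_of_fderiv_eq_zero x)] with T hT hker
  set f : M → (𝔼 k) := fun y => φ y + ∑ j, Ψ j y • T j with hf
  have hfd : HasFDerivAt (f ∘ c.symm) (A + ∑ j, (B j).smulRight (T j)) (c x) :=
    (hasFDerivAt_comp_chartAt_symm hφ x).add
      (HasFDerivAt.fun_sum fun j _ => (hasFDerivAt_comp_chartAt_symm (hΨ j) x).smul_const (T j))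
  have hO := hfd.isBigO_sub_of_ker_eq_bot (by
    rw [LinearMap.ker_eq_bot']
    intro v hv
    refine hker v ?_
    simpa [_root_.sum_apply] using hv)
  obtain ⟨C, hC⟩ := hO.bound
  obtain ⟨D, u, hu, hD⟩ := hρ.exists_nhds_edist_le_edist_chartAt x
  have hcont : ContinuousAt c x := c.continuousAt (mem_chart_source _ x)
  have hfc : Continuous f := by
    have := hφ.continuous
    have := fun j => (hΨ j).continuous
    fun_prop
  refine hX.exists_dist_le_mul_norm_sub hfc (C := D * C) ?_ hT
  filter_upwards [hu, hcont.eventually hC, chart_source_mem_nhds (𝔼 d) x] with y hy hyC hys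
  simp only [Function.comp_apply, hc, (chartAt (𝔼 d) x).left_inv hys,
    (chartAt (𝔼 d) x).left_inv (mem_chart_source _ x)] at hyC
  have h1 := hD x (mem_of_mem_nhds hu) y hy
  rw [edist_dist, edist_dist, ← ENNReal.ofReal_coe_nnreal, ← ENNReal.ofReal_mul D.coe_nonneg,
    ENNReal.ofReal_le_ofReal_iff (by positivity)] at h1
  rw [dist_comm (chartAt (𝔼 d) x x), dist_eq_norm] at h1
  rw [norm_sub_rev (f x), mul_assoc]
  exact h1.trans (by gcongr)

end LipschitzInverse

section Embedding

open Filter Asymptotics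
open scoped NNReal

local notation "𝔼" d:max => EuclideanSpace ℝ (Fin d)

/-- Two injective linear maps into the same finite-dimensional space differ by an automorphism. -/
lemma LinearMap.exists_linearEquiv_comp_eq {V W : Type*} [AddCommGroup V] [Module ℝ V]
    [AddCommGroup W] [Module ℝ W] [FiniteDimensional ℝ W] {i a : V →ₗ[ℝ] W}
    (hi : Function.Injective i) (ha : Function.Injective a) :
    ∃ e : W ≃ₗ[ℝ] W, ∀ v, e (i v) = a v := by
  obtain ⟨e, he⟩ := Submodule.exists_linearEquiv_restrict_eq
    ((LinearEquiv.ofInjective i hi).symm ≪≫ₗ LinearEquiv.ofInjective a ha)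
  refine ⟨e, fun v => ?_⟩
  have h := he (LinearEquiv.ofInjective i hi v)
  rw [LinearEquiv.trans_apply, LinearEquiv.symm_apply_apply] at h
  exact h.symm

/-- An immersion is locally the restriction of a diffeomorphism to a linear subspace. -/
theorem ContDiffOn.exists_openPartialHomeomorph_extension {V W : Type*}
    [NormedAddCommGroup V] [NormedSpace ℝ V] [NormedAddCommGroup W] [NormedSpace ℝ W]
    [FiniteDimensional ℝ W] {ι : V →L[ℝ] W} {q : W →L[ℝ] V} (hq : ∀ v, q (ι v) = v)
    {n : ℕ∞ω} (hn : 1 ≤ n) {f : V → W} {O : Set V} (hO : IsOpen O) (hf : ContDiffOn ℝ n f O)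
    {p : V} (hp : p ∈ O) (hinj : Function.Injective (fderiv ℝ f p)) :
    ∃ h : OpenPartialHomeomorph W W, ι p ∈ h.source ∧ (∀ w ∈ h.source, q w ∈ O) ∧
      ContDiffOn ℝ n h h.source ∧ ContDiffOn ℝ n h.symm h.target ∧ ∀ v, h (ι v) = f v := by
  have hn0 : n ≠ 0 := (zero_lt_one.trans_le hn).ne'
  have hcomplete : CompleteSpace W := FiniteDimensional.complete ℝ W
  set A := fderiv ℝ f p with hA
  obtain ⟨e, he⟩ := LinearMap.exists_linearEquiv_comp_eq
    (i := (ι : V →ₗ[ℝ] W)) (a := (A : V →ₗ[ℝ] W))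
    (Function.LeftInverse.injective hq) hinj
  set e' : W ≃L[ℝ] W := e.toContinuousLinearEquiv with he'
  have hee : ∀ v, e' (ι v) = A v := he
  set G : W → W := fun w => f (q w) + e' w - A (q w) with hG
  have hGι : ∀ v, G (ι v) = f v := fun v => by simp [hG, hq, hee]
  have hU : IsOpen (q ⁻¹' O) := hO.preimage q.continuous
  have hGd : ContDiffOn ℝ n G (q ⁻¹' O) := by
    have h1 : ContDiffOn ℝ n (fun w => f (q w)) (q ⁻¹' O) :=
      hf.comp q.contDiff.contDiffOn fun w hw => hw
    exact (h1.add e'.contDiff.contDiffOn).sub (A.contDiff.comp q.contDiff).contDiffOn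
  have hpU : ι p ∈ q ⁻¹' O := by simpa [hq] using hp
  have hGp : HasFDerivAt G (e' : W →L[ℝ] W) (ι p) := by
    have hfp : HasFDerivAt f A (q (ι p)) := by
      rw [hq]
      exact ((hf.contDiffAt (hO.mem_nhds hp)).differentiableAt hn0).hasFDerivAt
    have := ((hfp.comp (ι p) q.hasFDerivAt).add e'.hasFDerivAt).sub
      (A.hasFDerivAt.comp (ι p) q.hasFDerivAt)
    exact this.congr_fderiv (add_sub_cancel_left _ _)
  have hGat : ContDiffAt ℝ n G (ι p) := hGd.contDiffAt (hU.mem_nhds hpU)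
  set S := q ⁻¹' O ∩ fderiv ℝ G ⁻¹' range ContinuousLinearEquiv.toContinuousLinearMap with hS
  have hSo : IsOpen S := (hGd.continuousOn_fderiv_of_isOpen hU hn).isOpen_inter_preimage hU
    ContinuousLinearEquiv.isOpen
  have hpS : ι p ∈ S := ⟨hpU, e', hGp.fderiv.symm⟩
  set h := (hGat.toOpenPartialHomeomorph G hGp hn0).restrOpen S hSo with hh
  have hhG : ∀ w, h w = G w := fun w => rfl
  have hsub : h.source ⊆ S := inter_subset_right
  refine ⟨h, ⟨hGat.mem_toOpenPartialHomeomorph_source hGp hn0, hpS⟩, fun w hw => (hsub hw).1,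
    hGd.mono fun w hw => (hsub hw).1, fun w hw => ?_, hGι⟩
  have hws : h.symm w ∈ S := hsub (h.map_target hw)
  obtain ⟨L, hL⟩ := hws.2
  have hat : ContDiffAt ℝ n G (h.symm w) := hGd.contDiffAt (hU.mem_nhds hws.1)
  refine (h.contDiffAt_symm hw (f₀' := L) ?_ hat).contDiffWithinAt
  rw [hL]
  exact (hat.differentiableAt hn0).hasFDerivAt

lemma HasFDerivAt.injective_of_isBigO {V W : Type*} [NormedAddCommGroup V] [NormedSpace ℝ V]
    [NormedAddCommGroup W] [NormedSpace ℝ W] {f : V → W} {A : V →L[ℝ] W} {x : V}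
    (hf : HasFDerivAt f A x) (hO : (fun z => z - x) =O[𝓝 x] fun z => f z - f x) :
    Function.Injective A := by
  rw [injective_iff_map_eq_zero]
  intro v hv
  obtain ⟨C, hC⟩ := hO.bound
  by_contra hne
  have h1 : HasDerivAt (fun t : ℝ => f (x + t • v)) 0 0 := by
    have h2 : HasDerivAt (fun t : ℝ => x + t • v) v 0 := by
      simpa using ((hasDerivAt_id (0 : ℝ)).smul_const v).const_add x
    have h3 : HasFDerivAt f A (x + (0 : ℝ) • v) := by simpa using hf
    have := h3.comp_hasDerivAt (0 : ℝ) h2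
    rwa [hv] at this
  have hlim : Tendsto (fun t : ℝ => x + t • v) (𝓝 0) (𝓝 x) := by
    have : Continuous fun t : ℝ => x + t • v := by fun_prop
    simpa using this.tendsto 0
  have h4 := hasDerivAt_iff_isLittleO.1 h1
  have h5 : (fun t : ℝ => t) =O[𝓝 0] fun t : ℝ => f (x + t • v) - f x := by
    refine IsBigO.of_bound (‖v‖⁻¹ * C) ?_
    filter_upwards [hlim.eventually hC] with t ht
    rw [add_sub_cancel_left, norm_smul] at ht
    rw [mul_assoc, inv_mul_eq_div, le_div_iff₀ (norm_pos_iff.2 hne)]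
    exact ht
  have h6 : (fun t : ℝ => t) =o[𝓝 0] fun t : ℝ => t := by
    refine h5.trans_isLittleO ?_
    simpa using h4
  have h7 : ∃ᶠ t : ℝ in 𝓝[≠] 0, t ≠ 0 :=
    (eventually_mem_nhdsWithin (a := (0 : ℝ)) (s := {0}ᶜ)).frequently
  exact isLittleO_irrefl h7 (h6.mono nhdsWithin_le_nhds)

variable {d k : ℕ}

/-- The inclusion of `ℝ^d` into `ℝ^k` as the space of the first `d` coordinates. -/
noncomputable def EuclideanSpace.inclFirst (d k : ℕ) : (𝔼 d) →L[ℝ] (𝔼 k) :=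
  LinearMap.toContinuousLinearMap
    { toFun := fun z => WithLp.toLp 2 fun j => if h : (j : ℕ) < d then z ⟨j, h⟩ else 0
      map_add' := fun z w => by
        ext j
        by_cases h : (j : ℕ) < d <;> simp [h]
      map_smul' := fun a z => by
        ext j
        by_cases h : (j : ℕ) < d <;> simp [h] }

/-- The projection of `ℝ^k` onto the first `d` coordinates. -/
noncomputable def EuclideanSpace.projFirst (hdk : d ≤ k) : (𝔼 k) →L[ℝ] (𝔼 d) :=
  LinearMap.toContinuousLinearMap
    { toFun := fun w => WithLp.toLp 2 fun i => w (Fin.castLE hdk i)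
      map_add' := fun _ _ => rfl
      map_smul' := fun _ _ => rfl }

lemma EuclideanSpace.inclFirst_apply (z : 𝔼 d) (j : Fin k) :
    inclFirst d k z j = if h : (j : ℕ) < d then z ⟨j, h⟩ else 0 := rfl

lemma EuclideanSpace.projFirst_apply (hdk : d ≤ k) (w : 𝔼 k) (i : Fin d) :
    projFirst hdk w i = w (Fin.castLE hdk i) := rfl

lemma EuclideanSpace.projFirst_inclFirst (hdk : d ≤ k) (z : 𝔼 d) :
    projFirst hdk (inclFirst d k z) = z := by
  ext i
  simp [projFirst_apply, inclFirst_apply]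

lemma EuclideanSpace.inclFirst_projFirst (hdk : d ≤ k) {w : 𝔼 k}
    (hw : ∀ j : Fin k, d ≤ (j : ℕ) → w j = 0) : inclFirst d k (projFirst hdk w) = w := by
  ext j
  rw [inclFirst_apply]
  by_cases h : (j : ℕ) < d
  · simp [h, projFirst_apply]
  · simp [h, hw j (not_lt.1 h)]

variable {M : Type*} [MetricSpace M] [ChartedSpace (EuclideanSpace ℝ (Fin d)) M]

lemma IsRiemannianDist.exists_nhds_norm_chartAt_sub_le [CompactSpace M] [IsManifold (𝓡 d) 1 M]
    [RiemannianBundle (fun x : M => TangentSpace (𝓡 d) x)]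
    [IsContinuousRiemannianBundle (EuclideanSpace ℝ (Fin d))
      (fun x : M => TangentSpace (𝓡 d) x)] (hρ : IsRiemannianDist d M) (x : M) :
    ∃ C : ℝ≥0, ∀ᶠ y in 𝓝 x, ‖chartAt (𝔼 d) x y - chartAt (𝔼 d) x x‖ ≤ C * dist x y := by
  have b : SmoothBumpFunction (𝓡 d) x := Classical.choice inferInstance
  have : IsManifold (𝓡 d) ((1 : ℕ∞) : ℕ∞ω) M := inferInstanceAs (IsManifold (𝓡 d) 1 M)
  obtain ⟨C, u, hu, h⟩ := hρ.locallyLipschitz (b.contMDiff_smul_chartAt 1) x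
  refine ⟨C, ?_⟩
  filter_upwards [hu, b.eventuallyEq_one] with y hy hb
  have := h.dist_le_mul y hy x (mem_of_mem_nhds hu)
  simpa [hb, dist_eq_norm, dist_comm y x] using this

/-- A `C^r` map with a Lipschitz inverse at `x` is an embedding near `x`, with an image which is
relatively open in the range of the map. -/
theorem exists_isCrDiffeoOnto [CompactSpace M] {r : ℕ∞} (hr : 1 ≤ r)
    [IsManifold (𝓡 d) (r : ℕ∞ω) M] [IsManifold (𝓡 d) 1 M]
    [RiemannianBundle (fun x : M => TangentSpace (𝓡 d) x)]
    [IsContinuousRiemannianBundle (EuclideanSpace ℝ (Fin d))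
      (fun x : M => TangentSpace (𝓡 d) x)] (hρ : IsRiemannianDist d M) (hdk : d ≤ k)
    {φ : M → (𝔼 k)} (hφ : ContMDiff (𝓡 d) 𝓘(ℝ, (𝔼 k)) (r : ℕ∞ω) φ) {x : M} {C : ℝ}
    (hC : ∀ y, dist x y ≤ C * ‖φ x - φ y‖) :
    ∃ (U : Set M) (V : Set (𝔼 k)), IsOpen U ∧ x ∈ U ∧ IsOpen V ∧ φ x ∈ V ∧ φ ⁻¹' V = U ∧
      IsCrDiffeoOnto r d φ U (V ∩ range φ) := by
  have hr' : (1 : ℕ∞ω) ≤ (r : ℕ∞ω) := by exact_mod_cast hr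
  set c := chartAt (𝔼 d) x with hc
  have hxs : x ∈ c.source := mem_chart_source _ x
  have hxt : c x ∈ c.target := c.map_source hxs
  have hfd : ContDiffOn ℝ (r : ℕ∞ω) (φ ∘ c.symm) c.target :=
    contMDiffOn_iff_contDiffOn.1 (hφ.comp_contMDiffOn (contMDiffOn_chart_symm (I := 𝓡 d)))
  have hcont : Tendsto c.symm (𝓝 (c x)) (𝓝 x) := by
    have := c.symm.continuousAt (x := c x) hxt
    rwa [ContinuousAt, c.left_inv hxs] at this
  have hinj : Function.Injective (fderiv ℝ (φ ∘ c.symm) (c x)) := by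
    refine (hasFDerivAt_comp_chartAt_symm (hφ.of_le hr') x).injective_of_isBigO ?_
    obtain ⟨D, hD⟩ := hρ.exists_nhds_norm_chartAt_sub_le x
    refine IsBigO.of_bound (D * C) ?_
    filter_upwards [hcont.eventually hD, c.open_target.mem_nhds hxt] with z hz hzt
    rw [← hc, c.right_inv hzt] at hz
    rw [Function.comp_apply, Function.comp_apply, c.left_inv hxs, norm_sub_rev (φ _), mul_assoc]
    exact hz.trans (by gcongr; exact hC _)
  obtain ⟨h, hxh, hhO, hhd, hhsd, hhφ⟩ := hfd.exists_openPartialHomeomorph_extension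
    (EuclideanSpace.projFirst_inclFirst hdk) hr' c.open_target hxt hinj
  set ι := EuclideanSpace.inclFirst d k with hι
  set q := EuclideanSpace.projFirst hdk with hq
  have hhc : ∀ u ∈ c.source, h (ι (c u)) = φ u := fun u hu => by
    rw [hhφ, Function.comp_apply, c.left_inv hu]
  have hnhds : {u | u ∈ c.source ∧ ι (c u) ∈ h.source} ∈ 𝓝 x :=
    inter_mem (chart_source_mem_nhds _ x)
      ((ι.continuous.continuousAt.comp (c.continuousAt hxs)).preimage_mem_nhds
        (h.open_source.mem_nhds hxh))
  obtain ⟨ε, hε, hball⟩ := Metric.mem_nhds_iff.1 hnhds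
  set V := Metric.ball (φ x) (ε / (|C| + 1)) ∩ h.target with hV
  have hVo : IsOpen V := Metric.isOpen_ball.inter h.open_target
  have hxV : φ x ∈ V := by
    refine ⟨Metric.mem_ball_self (by positivity), ?_⟩
    rw [← hhc x hxs]
    exact h.map_source hxh
  have hU : ∀ u, φ u ∈ V → u ∈ c.source ∧ ι (c u) ∈ h.source := by
    intro u hu
    refine hball ?_
    have h1 := hu.1
    rw [Metric.mem_ball, dist_eq_norm, lt_div_iff₀ (by positivity), norm_sub_rev] at h1
    rw [Metric.mem_ball, dist_comm]
    calc dist x u ≤ C * ‖φ x - φ u‖ := hC u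
      _ ≤ ‖φ x - φ u‖ * (|C| + 1) := by
        rw [mul_comm]; gcongr; exact (le_abs_self C).trans (by linarith)
      _ < ε := h1
  have hqι : ∀ z, q (ι z) = z := EuclideanSpace.projFirst_inclFirst hdk
  have hhsymm : ∀ u, φ u ∈ V → h.symm (φ u) = ι (c u) := fun u hu => by
    rw [← hhc u (hU u hu).1, h.left_inv (hU u hu).2]
  refine ⟨φ ⁻¹' V, V, hVo.preimage hφ.continuous, hxV, hVo, hxV, rfl, ?_⟩
  refine ⟨hVo.preimage hφ.continuous, ⟨hdk, fun y hy => ?_⟩, ⟨?_, ?_, ?_⟩, hφ.contMDiffOn,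
    fun y hy => ⟨V, hVo, hy.1, fun w => c.symm (q (h.symm w)), ?_, ?_⟩⟩
  · refine ⟨h.symm.restrOpen V hVo, ⟨hy.1.2, hy.1⟩, hhsd.mono inter_subset_left, ?_, ?_⟩
    · exact hhd.mono inter_subset_left
    · have hsrc : (h.symm.restrOpen V hVo).source = V := inter_eq_right.2 inter_subset_right
      have htgt : (h.symm.restrOpen V hVo).target = h.source ∩ h ⁻¹' V := rfl
      rw [hsrc, htgt]
      ext w
      constructor
      · rintro ⟨_, ⟨hV1, -, ⟨u, rfl⟩⟩, rfl⟩
        change h.symm (φ u) ∈ _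
        rw [hhsymm u hV1]
        refine ⟨⟨(hU u hV1).2, ?_⟩, fun i hi => ?_⟩
        · rw [mem_preimage, hhc u (hU u hV1).1]; exact hV1
        · rw [hι, EuclideanSpace.inclFirst_apply, dif_neg (not_lt.2 hi)]
      · rintro ⟨⟨hw, hwV⟩, hw0⟩
        have hwι : ι (q w) = w := EuclideanSpace.inclFirst_projFirst hdk hw0
        have hφw : φ (c.symm (q w)) = h w := by
          rw [← hwι, hhφ, hwι]; rfl
        refine ⟨h w, ⟨hwV, hwV, ⟨_, hφw⟩⟩, h.left_inv hw⟩
  · exact fun u hu => ⟨hu, mem_range_self u⟩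
  · intro u hu w hw huw
    have h1 := hhsymm u hu
    rw [huw, hhsymm w hw] at h1
    have h2 := congrArg q h1
    rw [hqι, hqι] at h2
    exact c.injOn (hU u hu).1 (hU w hw).1 h2.symm
  · rintro _ ⟨hu, u, rfl⟩
    exact ⟨u, hu, rfl⟩
  · refine (contMDiffOn_chart_symm (I := 𝓡 d) (x := x)).comp (t := c.target) ?_ ?_
    · exact contMDiffOn_iff_contDiffOn.2
        (q.contDiff.comp_contDiffOn (hhsd.mono inter_subset_right))
    · exact fun w hw => hhO _ (h.map_target hw.2)
  · intro u hu _
    change c.symm (q (h.symm (φ u))) = u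
    rw [hhsymm u hu, hqι, c.left_inv (hU u hu).1]

end Embedding

section CrTopology

open Filter

local notation "𝔼" d:max => EuclideanSpace ℝ (Fin d)

variable {d : ℕ} {M : Type*} [TopologicalSpace M]
  [ChartedSpace (EuclideanSpace ℝ (Fin d)) M]
  {F : Type*} [NormedAddCommGroup F] [NormedSpace ℝ F] {r : ℕ∞}

/-- Finite-dimensional families of `C^r` maps depend continuously on their coefficients. -/
lemma ContMDiffMap.continuous_of_eq_sum_smul {P A : Type*} [TopologicalSpace P] [Fintype A]
    {t : A → P → ℝ} (ht : ∀ a, Continuous (t a)) {f : A → M → F}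
    (hf : ∀ a, ContMDiff (𝓡 d) 𝓘(ℝ, F) (r : ℕ∞ω) (f a))
    {G : P → C^(r : ℕ∞ω)⟮𝓡 d, M; 𝓘(ℝ, F), F⟯} (hG : ∀ p x, G p x = ∑ a, t a p • f a x) :
    Continuous G := by
  refine continuous_iInf_rng.2 fun c => continuous_iInf_rng.2 fun hc =>
    continuous_iInf_rng.2 fun j => continuous_iInf_rng.2 fun hj => continuous_induced_rng.2 ?_
  rw [continuous_iff_continuousAt]
  intro p₀
  rw [ContinuousAt, UniformOnFun.tendsto_iff_tendstoUniformlyOn]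
  rintro K ⟨hK, hKc⟩
  have hfc : ∀ a, ContDiffOn ℝ (r : ℕ∞ω) (f a ∘ c.symm) c.target := fun a =>
    contMDiffOn_iff_contDiffOn.1 ((hf a).comp_contMDiffOn (contMDiffOn_symm_of_mem_maximalAtlas hc))
  have hj' : (j : ℕ∞ω) ≤ (r : ℕ∞ω) := by exact_mod_cast hj
  have hcont : ∀ a, ContinuousOn (iteratedFDeriv ℝ j (f a ∘ c.symm)) K := fun a =>
    (((hfc a).continuousOn_iteratedFDerivWithin hj' c.open_target.uniqueDiffOn).congr
      fun z hz => (iteratedFDerivWithin_of_isOpen j c.open_target hz).symm).mono hKc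
  choose b hb using fun a => hK.exists_bound_of_continuousOn (hcont a)
  have hsum : ∀ p, ∀ z ∈ K, iteratedFDeriv ℝ j (fun z => G p (c.symm z)) z =
      ∑ a, t a p • iteratedFDeriv ℝ j (f a ∘ c.symm) z := by
    intro p z hz
    have h1 : ∀ a, ContDiffAt ℝ j (f a ∘ c.symm) z := fun a =>
      ((hfc a).contDiffAt (c.open_target.mem_nhds (hKc hz))).of_le hj'
    simp_rw [hG]
    have h2 := iteratedFDeriv_fun_sum_apply (𝕜 := ℝ) (n := j) (x := z) (u := Finset.univ)
      (f := fun a => t a p • (f a ∘ c.symm)) fun a _ => (h1 a).const_smul (t a p)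
    refine h2.trans (Finset.sum_congr rfl fun a _ => iteratedFDeriv_const_smul_apply (h1 a))
  rw [Metric.tendstoUniformlyOn_iff]
  intro ε hε
  have hlim : Tendsto (fun p => ∑ a, |t a p₀ - t a p| * b a) (𝓝 p₀) (𝓝 0) := by
    have : Continuous fun p => ∑ a, |t a p₀ - t a p| * b a := by fun_prop
    simpa using this.tendsto p₀
  filter_upwards [hlim.eventually_lt_const hε] with p hp z hz
  refine lt_of_le_of_lt ?_ hp
  change dist (iteratedFDeriv ℝ j (fun z => G p₀ (c.symm z)) z)
    (iteratedFDeriv ℝ j (fun z => G p (c.symm z)) z) ≤ _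
  rw [hsum p₀ z hz, hsum p z hz, dist_eq_norm, ← Finset.sum_sub_distrib]
  refine (norm_sum_le _ _).trans (Finset.sum_le_sum fun a _ => ?_)
  rw [← sub_smul, norm_smul, Real.norm_eq_abs]
  gcongr
  exact hb a z hz

/-- The continuous map underlying a `C^r` map. -/
noncomputable def ContMDiffMap.toContinuousMap (f : C^(r : ℕ∞ω)⟮𝓡 d, M; 𝓘(ℝ, F), F⟯) : C(M, F) :=
  ⟨f, f.contMDiff.continuous⟩

lemma ContMDiffMap.continuous_toContinuousMap [CompactSpace M] [T2Space M]
    [IsManifold (𝓡 d) (r : ℕ∞ω) M] :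
    Continuous (toContinuousMap (d := d) (M := M) (F := F) (r := r)) := by
  rw [continuous_iff_continuousAt]
  intro f
  rw [ContinuousAt, ContinuousMap.tendsto_iff_tendstoLocallyUniformly]
  intro u hu x
  set c := chartAt (𝔼 d) x with hc
  have hcont : Continuous fun f : C^(r : ℕ∞ω)⟮𝓡 d, M; 𝓘(ℝ, F), F⟯ =>
      UniformOnFun.ofFun {K : Set (𝔼 d) | IsCompact K ∧ K ⊆ c.target}
        (iteratedFDeriv ℝ 0 (fun z => f (c.symm z))) :=
    continuous_iInf_dom (i := c) <| continuous_iInf_dom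
      (i := IsManifold.chart_mem_maximalAtlas x) <| continuous_iInf_dom (i := 0) <|
      continuous_iInf_dom (i := by simp) continuous_induced_dom
  obtain ⟨K, hKn, hKc, hK⟩ := local_compact_nhds
    (c.open_target.mem_nhds (c.map_source (mem_chart_source (𝔼 d) x)))
  have h1 := UniformOnFun.tendsto_iff_tendstoUniformlyOn.1 (hcont.tendsto f) K ⟨hK, hKc⟩
  obtain ⟨ε, hε, hεu⟩ := Metric.mem_uniformity_dist.1 hu
  rw [Metric.tendstoUniformlyOn_iff] at h1
  refine ⟨c.source ∩ c ⁻¹' K, inter_mem (chart_source_mem_nhds _ x)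
    ((c.continuousAt (mem_chart_source _ x)).preimage_mem_nhds hKn), ?_⟩
  filter_upwards [h1 ε hε] with g hg y hy
  refine hεu ?_
  have h2 := hg (c y) hy.2
  change dist (iteratedFDeriv ℝ 0 (fun z => f (c.symm z)) (c y))
    (iteratedFDeriv ℝ 0 (fun z => g (c.symm z)) (c y)) < ε at h2
  rw [iteratedFDeriv_zero_eq_comp, iteratedFDeriv_zero_eq_comp, Function.comp_apply,
    Function.comp_apply, LinearIsometryEquiv.dist_map, c.left_inv hy.1] at h2
  exact h2

end CrTopology

section Prevalence

open Filter

local notation "𝔼" d:max => EuclideanSpace ℝ (Fin d)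

lemma IsPrevalent.mono {V : Type*} [AddCommGroup V] [TopologicalSpace V] {S T : Set V}
    (hS : IsPrevalent S) (h : S ⊆ T) : IsPrevalent T := by
  obtain ⟨B, hB, hrest⟩ := hS
  exact ⟨B, hB.trans h, hrest⟩

lemma isPrevalent_univ {V : Type*} [AddCommGroup V] [TopologicalSpace V] :
    IsPrevalent (univ : Set V) := by
  borelize V
  refine ⟨univ, Subset.rfl, MeasurableSet.univ, Measure.dirac 0, ⟨{0}, isCompact_singleton, ?_⟩,
    fun v => by simp⟩
  rw [Measure.dirac_apply_of_mem (mem_singleton 0)]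
  simp

/-- Existence of a finite-dimensional probe. -/
lemma isPrevalent_of_probe {V P : Type*} [AddCommGroup V] [TopologicalSpace V]
    [NormedAddCommGroup P] [NormedSpace ℝ P] [FiniteDimensional ℝ P] [MeasureSpace P]
    [BorelSpace P] [(volume : Measure P).IsAddHaarMeasure] {L : P → V} (hL : Continuous L)
    {B : Set V} (hB : MeasurableSet[borel V] B)
    (hBadd : ∀ v, MeasurableSet[borel V] {e | v + e ∈ B}) (h : ∀ v, ∀ᵐ T : P, v + L T ∈ B) :
    IsPrevalent B := by
  borelize V
  refine ⟨B, Subset.rfl, hB, (volume.restrict (Metric.closedBall (0 : P) 1)).map L,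
    ⟨L '' Metric.closedBall 0 1, (isCompact_closedBall _ _).image hL, ?_, ?_⟩, fun v => ?_⟩
  · refine lt_of_lt_of_le ?_ (Measure.le_map_apply hL.aemeasurable _)
    refine lt_of_lt_of_le ?_ (measure_mono (subset_preimage_image _ _))
    rw [Measure.restrict_apply_self]
    exact Metric.measure_closedBall_pos _ _ one_pos
  · have : IsFiniteMeasure (volume.restrict (Metric.closedBall (0 : P) 1)) :=
      ⟨by rw [Measure.restrict_apply_univ]; exact measure_closedBall_lt_top⟩
    exact measure_lt_top _ _
  · have hm : MeasurableSet {e : V | v + e ∉ B} := (hBadd v).compl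
    rw [Measure.map_apply hL.measurable hm]
    exact Measure.absolutelyContinuous_of_le Measure.restrict_le_self (ae_iff.1 (h v))

lemma measurableSet_exists_dist_le_mul_norm_sub {M F : Type*} [MetricSpace M] [CompactSpace M]
    [MeasurableSpace M] [BorelSpace M] [NormedAddCommGroup F] [SecondCountableTopology F]
    [MeasurableSpace C(M, F)] [BorelSpace C(M, F)] (X Y : Set M) :
    MeasurableSet {p : X × C(M, F) | ∃ C : ℝ, 0 ≤ C ∧
      ∀ y ∈ Y, dist (p.1 : M) y ≤ C * ‖p.2 p.1 - p.2 y‖} := by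
  have : {p : X × C(M, F) | ∃ C : ℝ, 0 ≤ C ∧
      ∀ y ∈ Y, dist (p.1 : M) y ≤ C * ‖p.2 p.1 - p.2 y‖} =
      ⋃ n : ℕ, {p | ∀ y ∈ Y, dist (p.1 : M) y ≤ n * ‖p.2 p.1 - p.2 y‖} := by
    ext p
    simp only [mem_iUnion, mem_ofPred_eq]
    refine ⟨fun ⟨C, _, hC⟩ => ?_, fun ⟨n, hn⟩ => ⟨n, n.cast_nonneg, hn⟩⟩
    obtain ⟨n, hn⟩ := exists_nat_ge C
    exact ⟨n, fun y hy => (hC y hy).trans (by gcongr)⟩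
  rw [this]
  refine MeasurableSet.iUnion fun n => IsClosed.measurableSet ?_
  simp only [ofPred_forall]
  exact isClosed_biInter fun y _ => isClosed_le (by fun_prop) (by fun_prop)

variable {d k : ℕ} {r : ℕ∞} {M : Type*} [MetricSpace M] [CompactSpace M]
  [ChartedSpace (EuclideanSpace ℝ (Fin d)) M] [IsManifold (𝓡 d) (r : ℕ∞ω) M]
  [IsManifold (𝓡 d) 1 M] [RiemannianBundle (fun x : M => TangentSpace (𝓡 d) x)]
  [IsContinuousRiemannianBundle (EuclideanSpace ℝ (Fin d)) (fun x : M => TangentSpace (𝓡 d) x)]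
  [MeasurableSpace M] [BorelSpace M]

/-- Prevalent `C^r` maps have, on a compact set of dimension smaller than `k`, a pointwise
Lipschitz inverse at almost every point. -/
theorem isPrevalent_ae_exists_dist_le_mul_norm_sub (hr : 1 ≤ r) (hρ : IsRiemannianDist d M)
    {X : Set M} (μ : Measure X) [SFinite μ] {Y : Set M} (hY : IsCompact Y) (hYk : dimH Y < k)
    (hdk : d ≤ k) :
    IsPrevalent {φ : C^(r : ℕ∞ω)⟮𝓡 d, M; 𝓘(ℝ, 𝔼 k), 𝔼 k⟯ |
      ∀ᵐ x : X ∂μ, ∃ C : ℝ, 0 ≤ C ∧ ∀ y ∈ Y, dist (x : M) y ≤ C * ‖φ x - φ y‖} := by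
  have hr' : (1 : ℕ∞ω) ≤ (r : ℕ∞ω) := by exact_mod_cast hr
  borelize C(M, 𝔼 k)
  obtain ⟨t, Ψ, hΨ, hsep⟩ := exists_isSeparatingImmersion (d := d) (M := M) r
  set V := C^(r : ℕ∞ω)⟮𝓡 d, M; 𝓘(ℝ, 𝔼 k), 𝔼 k⟯
  set L : (t × Option (Fin d) → 𝔼 k) → V := fun T => ⟨fun x => ∑ j, Ψ j x • T j,
    contMDiff_finsetSum fun j _ => (hΨ j).smul contMDiff_const⟩ with hL
  have hLc : Continuous L := by
    refine ContMDiffMap.continuous_of_eq_sum_smul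
      (A := (t × Option (Fin d)) × Fin k) (t := fun a T => T a.1 a.2)
      (f := fun a x => Ψ a.1 x • EuclideanSpace.single a.2 (1 : ℝ)) (fun a => by fun_prop)
      (fun a => (hΨ a.1).smul contMDiff_const) fun T x => ?_
    change ∑ j, Ψ j x • T j = _
    refine (Finset.sum_congr rfl fun j _ => ?_).trans (Fintype.sum_prod_type _).symm
    ext i
    simp [Pi.single_apply, mul_comm]
  have hA := measurableSet_exists_dist_le_mul_norm_sub (F := 𝔼 k) X Y
  set A := {p : X × C(M, 𝔼 k) | ∃ C : ℝ, 0 ≤ C ∧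
      ∀ y ∈ Y, dist (p.1 : M) y ≤ C * ‖p.2 p.1 - p.2 y‖} with hAdef
  set B₀ : Set C(M, 𝔼 k) := {f | ∀ᵐ x ∂μ, (x, f) ∈ A} with hB₀
  have hB₀m : MeasurableSet B₀ := by
    have := measurable_measure_prodMk_right (μ := μ) hA.compl (measurableSet_singleton 0)
    exact this
  have hBc := ContMDiffMap.continuous_toContinuousMap (d := d) (M := M) (F := 𝔼 k) (r := r)
  borelize V
  refine isPrevalent_of_probe (B := ContMDiffMap.toContinuousMap ⁻¹' B₀) hLc
    (hBc.measurable hB₀m) (fun v => ?_) fun v => ?_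
  · have : Continuous fun e : V => v.toContinuousMap + e.toContinuousMap := by fun_prop
    exact this.measurable hB₀m
  · have hLc' : Continuous fun T => v.toContinuousMap + (L T).toContinuousMap :=
      continuous_const.add (hBc.comp hLc)
    have hmeas : Measurable fun p : X × (t × Option (Fin d) → 𝔼 k) =>
        (p.1, v.toContinuousMap + (L p.2).toContinuousMap) :=
      measurable_fst.prodMk (hLc'.measurable.comp measurable_snd)
    refine (Measure.ae_ae_comm (p := fun x T =>
      (x, v.toContinuousMap + (L T).toContinuousMap) ∈ A) (hmeas hA)).1 (Eventually.of_forall fun x => ?_)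
    exact ae_exists_dist_le_mul_norm_sub hρ hY hYk hdk (fun j => (hΨ j).of_le hr') hsep
      (v.contMDiff.of_le hr') (x : M)

end Prevalence

theorem theorem1p2 (r : ℕ∞) (hr : 1 ≤ r) (d k : ℕ)
    {M : Type*} [MetricSpace M] [CompactSpace M]
    [ChartedSpace (EuclideanSpace ℝ (Fin d)) M]
    [IsManifold (𝓡 d) (r : ℕ∞ω) M] [IsManifold (𝓡 d) 1 M]
    [RiemannianBundle (fun x : M => TangentSpace (𝓡 d) x)]
    [IsContinuousRiemannianBundle (EuclideanSpace ℝ (Fin d))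
      (fun x : M => TangentSpace (𝓡 d) x)]
    (hρ : IsRiemannianDist d M)
    [MeasurableSpace M] [BorelSpace M]
    (X : Set M) (hX : IsCompact X) (μ : Measure X) [IsProbabilityMeasure μ] :
    IsPrevalent
      {φ : C^(r : ℕ∞ω)⟮𝓡 d, M; 𝓘(ℝ, EuclideanSpace ℝ (Fin k)), EuclideanSpace ℝ (Fin k)⟯ |
        (dimH X < (k : ℝ≥0∞) → d ≤ k →
          ∀ᵐ x : X ∂μ, ∃ C : ℝ, 0 ≤ C ∧ ∀ y ∈ X, dist (x : M) y ≤ C * ‖φ x - φ y‖) ∧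
        (d < k →
          ∀ᵐ x : X ∂μ, ∃ (U : Set M) (V : Set (EuclideanSpace ℝ (Fin k))),
            IsOpen U ∧ (x : M) ∈ U ∧ IsOpen V ∧ φ x ∈ V ∧ φ ⁻¹' V = U ∧
            IsCrDiffeoOnto r d φ U (V ∩ range φ))} := by
  by_cases hdk : d < k
  · have hdim : dimH (univ : Set M) < k :=
      hρ.dimH_univ_le.trans_lt (by exact_mod_cast hdk)
    refine (isPrevalent_ae_exists_dist_le_mul_norm_sub hr hρ μ isCompact_univ hdim
      hdk.le).mono fun φ hφ => ⟨fun _ _ => ?_, fun _ => ?_⟩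
    · filter_upwards [hφ] with x ⟨C, hC, h⟩
      exact ⟨C, hC, fun y _ => h y (mem_univ y)⟩
    · filter_upwards [hφ] with x ⟨C, _, h⟩
      exact exists_isCrDiffeoOnto hr hρ hdk.le φ.contMDiff fun y => h y (mem_univ y)
  · by_cases hXk : dimH X < k ∧ d ≤ k
    · exact (isPrevalent_ae_exists_dist_le_mul_norm_sub hr hρ μ hX hXk.1 hXk.2).mono
        fun φ hφ => ⟨fun _ _ => hφ, fun h => (hdk h).elim⟩
    · exact isPrevalent_univ.mono fun φ _ =>
        ⟨fun h h' => (hXk ⟨h, h'⟩).elim, fun h => (hdk h).elim⟩
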